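/- Let $G$ be a finite group of order $\ell$, let $e_\ell$ be the least prime divisor of $\ell$, and let $2\le q\le e_\ell$. Let $X$ be a paracompact Hausdorff space with a free (continuous, left) action of $G$, and let $Y$ be a Hausdorff space. Let $$F(Y,\ell,q)=\{(y_1,\dots,y_\ell)\in Y^\ell:\ \text{for all } 0<i_1<\dots<i_q\le\ell,\ \text{at least two of } y_{i_1},\dots,y_{i_q}\ \text{are different}\}$$ with the subspace topology. Fix an enumeration $G=\{g_1,\dots,g_\ell\}$, write $h(g_j)=j$, and let $G$ act on $F(Y,\ell,q)$ by $g(y_1,\dots,y_\ell)=(y_{h(g^{-1}g_1)},\dots,y_{h(g^{-1}g_\ell)})$. For a continuous map $p:E\to B$ let $\mathrm{secat}(p)\in\{0,1,2,\dots,\infty\}$ be the minimal cardinality of an open cover of $B$ over each member of which $p$ has a continuous local section ($\infty$ if there is no finite such cover). For an integer $n$, a space $S$ is called $n$-connected if for each $k=-1,0,\dots,n$ every continuous map from the sphere $S^k$ to $S$ extends continuously to the ball $D^{k+1}$ (so $(-1)$-connected means nonempty, and every space is $(-2)$-connected); its connectivity is at least $n$ if it is $n$-connected, and at least $\infty$ if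 it is $n$-connected for all $n$. Assume that the connectivity of $F(Y,\ell,q)$ is at least $\mathrm{secat}\left(F(Y,\ell,q)\to F(Y,\ell,q)/G\right)-2$. Then the following statements are equivalent. 1. $\mathrm{secat}(X\to X/G)>\mathrm{secat}\left(F(Y,\ell,q)\to F(Y,\ell,q)/G\right)$. 2. The triple $(X,G;Y)$ has the $q$-th Borsuk-Ulam property ($q$-th BUP): for every continuous map $f:X\to Y$ there are a point $x\in X$ and distinct elements $u_1,\dots,u_q\in G$ such that $f(u_1x)=\dots=f(u_qx)$. -/

import Mathlib

open Set

section SectionalCategory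

/-- A local section of `p : E → B` over the subset `A` of `B`: a continuous map `s : A → E` such
that `p ∘ s` is the inclusion of `A` in `B`. -/
def IsLocalSection {E B : Type*} [TopologicalSpace E] [TopologicalSpace B] (p : E → B)
    (A : Set B) (s : A → E) : Prop :=
  Continuous s ∧ ∀ b : A, p (s b) = (b : B)

/-- `𝒰` is an open cover of `B` each of whose members admits a local section of `p`. -/
def IsSectionalCover {E B : Type*} [TopologicalSpace E] [TopologicalSpace B] (p : E → B)
    (𝒰 : Set (Set B)) : Prop :=
  (∀ U ∈ 𝒰, IsOpen U) ∧ ⋃₀ 𝒰 = univ ∧ ∀ U ∈ 𝒰, ∃ s : U → E, IsLocalSection p U s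

/-- The (non-reduced) sectional category of `p : E → B`: the minimal cardinality of an open cover
of `B` each of whose members admits a local section; it is `⊤` if there is no finite such cover. -/
noncomputable def secat {E B : Type*} [TopologicalSpace E] [TopologicalSpace B] (p : E → B) : ℕ∞ :=
  sInf {n : ℕ∞ | ∃ 𝒰 : Set (Set B), IsSectionalCover p 𝒰 ∧ 𝒰.encard = n}

/-- The quotient map `X → X/G` onto the space of orbits (with the quotient topology). -/
def orbitMap (G X : Type*) [Group G] [MulAction G X] : X → MulAction.orbitRel.Quotient G X :=
  Quotient.mk (MulAction.orbitRel G X)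

/-- The sectional category of the quotient map `X → X/G`. -/
noncomputable def secatOrbit (G X : Type*) [Group G] [TopologicalSpace X] [MulAction G X] : ℕ∞ :=
  secat (orbitMap G X)

end SectionalCategory

section Connectivity

/-- A space `X` is `n`-connected (`n` an integer) if for every `k = -1, 0, …, n` every continuous
map from the sphere `S^k` to `X` extends continuously to the ball `D^(k+1)`. Here `S^k` is the unit
sphere of `ℝ^(k+1)` and `d` plays the role of `k + 1`; for `d = 0` the sphere is empty and the ball
is a point, so `(-1)`-connected means nonempty, and every space is `(-2)`-connected. -/
def IsNConnected (n : ℤ) (X : Type*) [TopologicalSpace X] : Prop :=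
  ∀ d : ℕ, (d : ℤ) ≤ n + 1 →
    ∀ f : C(Metric.sphere (0 : EuclideanSpace ℝ (Fin d)) 1, X),
      ∃ F : C(Metric.closedBall (0 : EuclideanSpace ℝ (Fin d)) 1, X),
        ∀ x : Metric.sphere (0 : EuclideanSpace ℝ (Fin d)) 1,
          F ⟨x, Metric.sphere_subset_closedBall x.2⟩ = f x

end Connectivity

section BorsukUlam

/-- The action of `G` on `X` is free: only the identity fixes a point. -/
def IsFreeAction (G X : Type*) [Group G] [MulAction G X] : Prop :=
  ∀ (g : G) (x : X), g • x = x → g = 1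

/-- The triple `(X, G; Y)` has the `q`-th Borsuk-Ulam property: for every map `f : X → Y` there are
a point `x` and `q` distinct elements `u₁, …, u_q` of `G` with `f (u₁ x) = ⋯ = f (u_q x)`. -/
def HasBUP (X G Y : Type*) [Group G] [TopologicalSpace X] [MulAction G X] [TopologicalSpace Y]
    (q : ℕ) : Prop :=
  ∀ f : C(X, Y), ∃ x : X, ∃ u : Fin q → G,
    Function.Injective u ∧ ∀ i j : Fin q, f (u i • x) = f (u j • x)

end BorsukUlam

section Configurations

/-- The configuration-like space `F(Y, ℓ, q)`, a subset of `Y^ℓ`: the tuples `(y_1, …, y_ℓ)` such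
that among any `q` coordinates (with distinct indices) at least two are different. -/
def confSet (Y : Type*) (ℓ q : ℕ) : Set (Fin ℓ → Y) :=
  {y | ∀ S : Finset (Fin ℓ), S.card = q → ∃ i ∈ S, ∃ j ∈ S, y i ≠ y j}

/-- The space `F(Y, ℓ, q)` with the topology induced from `Y^ℓ`. The enumeration
`h : G ≃ Fin ℓ` of the group does not enter the space; it is recorded in the type because the action
of `G` depends on it. -/
def ConfSpace {G : Type*} {ℓ : ℕ} (_h : G ≃ Fin ℓ) (Y : Type*) (q : ℕ) : Type _ :=
  confSet Y ℓ q

instance {G : Type*} {ℓ : ℕ} (h : G ≃ Fin ℓ) (Y : Type*) [TopologicalSpace Y] (q : ℕ) :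
    TopologicalSpace (ConfSpace h Y q) :=
  inferInstanceAs (TopologicalSpace (confSet Y ℓ q))

theorem confSet_comp_equiv {Y : Type*} {ℓ q : ℕ} {y : Fin ℓ → Y} (hy : y ∈ confSet Y ℓ q)
    (σ : Fin ℓ ≃ Fin ℓ) : (fun j => y (σ j)) ∈ confSet Y ℓ q := by
  intro S hS
  obtain ⟨i, hi, j, hj, hij⟩ := hy (S.map σ.toEmbedding) (by simpa using hS)
  obtain ⟨a, ha, rfl⟩ := Finset.mem_map.1 hi
  obtain ⟨b, hb, rfl⟩ := Finset.mem_map.1 hj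
  exact ⟨a, ha, b, hb, hij⟩

/-- With `g_j = h⁻¹(j)`, the group `G = {g_1, …, g_ℓ}` acts on `F(Y, ℓ, q)` on the left by
`g (y_1, …, y_ℓ) = (y_{h(g⁻¹ g_1)}, …, y_{h(g⁻¹ g_ℓ)})`. -/
instance {G : Type*} [Group G] {ℓ : ℕ} (h : G ≃ Fin ℓ) (Y : Type*) (q : ℕ) :
    MulAction G (ConfSpace h Y q) where
  smul g y := ⟨fun j => y.1 (h (g⁻¹ * h.symm j)),
    confSet_comp_equiv y.2 ((h.symm.trans (Equiv.mulLeft g⁻¹)).trans h)⟩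
  one_smul y := Subtype.ext (funext fun j => by
    change y.1 (h ((1 : G)⁻¹ * h.symm j)) = y.1 j
    simp)
  mul_smul a b y := Subtype.ext (funext fun j => by
    change y.1 (h ((a * b)⁻¹ * h.symm j)) = y.1 (h (b⁻¹ * h.symm (h (a⁻¹ * h.symm j))))
    simp [mul_assoc])

end Configurations

/-! ### Slices of free actions and sectional covers -/

section Slices

/-! A map `f : X → Y` violating the Borsuk-Ulam property is the same thing as an equivariant map `X
→ F(Y, ℓ, q)`, namely `x ↦ (f (g_j⁻¹ x))_j` (`hasBUP_iff_not_exists_equivariant`). So the theorem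
says that such an equivariant map exists iff `secat (X → X/G) ≤ secat (F → F/G)`.

The action on `F` is free: a nontrivial `g` has order at least `q`, because `q` is at most the least
prime divisor of `ℓ`, so a point fixed by `g` would have `q` equal coordinates. For free actions of
a finite group on Hausdorff spaces, open sets with a local section are exactly the images of open
slices, and slices pull back along equivariant maps; hence an equivariant map forces the inequality
(`secatOrbit_le_of_equivariant`).

Conversely, let `X/G` be covered by at most `secat (F → F/G)` open sets with sections. The
translates of the corresponding slices, with an equivariant partition of unity, give barycentric
coordinates for `X` in the join of copies of `G`, one for each member of the cover
(`exists_equivariant_coordinates`). This join is a free complex, and the number of vertices of a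
simplex is bounded by the size of the cover. The connectivity of `F` is just enough to build an
equivariant map from the join to `F` skeleton by skeleton (`IsFreeComplex.exists_equivariant`). An
infinite cover causes no trouble: simplices stay finite, and `F` is then connected in all degrees.
-/

theorem orbitMap_eq_iff {G X : Type*} [Group G] [MulAction G X] {x y : X} :
    orbitMap G X x = orbitMap G X y ↔ ∃ g : G, g • y = x := by
  rw [orbitMap, Quotient.eq]
  exact MulAction.orbitRel_apply

variable {G X : Type*} [Group G] [TopologicalSpace X] [MulAction G X]

theorem continuous_orbitMap : Continuous (orbitMap G X) := continuous_quotient_mk'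

theorem isOpenMap_orbitMap [ContinuousConstSMul G X] : IsOpenMap (orbitMap G X) :=
  isOpenMap_quotient_mk'_mul

variable (G) in
/-- An open slice: an open set meeting each orbit of a free action in at most one point. -/
def IsOpenSlice (A : Set X) : Prop :=
  IsOpen A ∧ ∀ a ∈ A, ∀ g : G, g • a ∈ A → g = 1

theorem IsOpenSlice.injOn {A : Set X} (hA : IsOpenSlice G A) : InjOn (orbitMap G X) A := by
  intro a ha b hb hab
  obtain ⟨g, rfl⟩ := orbitMap_eq_iff.1 hab
  rw [hA.2 b hb g ha, one_smul]

variable [ContinuousConstSMul G X]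

/-- The orbit map is open, and injective on a slice, so it restricts to an open embedding; the
section is its inverse. -/
theorem IsOpenSlice.exists_isLocalSection {A : Set X} (hA : IsOpenSlice G A) :
    ∃ s : orbitMap G X '' A → X, IsLocalSection (orbitMap G X) (orbitMap G X '' A) s := by
  have hemb : Topology.IsOpenEmbedding (A.domRestrict (orbitMap G X)) :=
    .of_continuous_injective_isOpenMap (continuous_orbitMap.comp continuous_subtype_val)
      hA.injOn.injective (isOpenMap_orbitMap.comp hA.1.isOpenMap_subtype_val)
  let e := hemb.toIsEmbedding.toHomeomorph
  have hmem (b : orbitMap G X '' A) : (b : MulAction.orbitRel.Quotient G X) ∈ range (A.domRestrict (orbitMap G X)) := by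
    rw [range_domRestrict]; exact b.2
  refine ⟨fun b => (e.symm ⟨b, hmem b⟩ : A), ?_, fun b => ?_⟩
  · exact continuous_subtype_val.comp (e.symm.continuous.comp (by fun_prop))
  · exact congrArg Subtype.val (e.apply_symm_apply ⟨b, hmem b⟩)

/-- The slice is the image of the section, described as the set of `x` equal to the point `r x` that
the section selects in the orbit of `x`. -/
theorem IsLocalSection.exists_isOpenSlice [Finite G] [T2Space X] (hfree : IsFreeAction G X)
    {U : Set (MulAction.orbitRel.Quotient G X)} (hU : IsOpen U) {s : U → X}
    (hs : IsLocalSection (orbitMap G X) U s) :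
    ∃ A : Set X, IsOpenSlice G A ∧ orbitMap G X '' A = U := by
  let W : Set X := orbitMap G X ⁻¹' U
  have hW : IsOpen W := hU.preimage continuous_orbitMap
  let r : W → X := fun x => s ⟨orbitMap G X x, x.2⟩
  have hr : Continuous r :=
    hs.1.comp ((continuous_orbitMap.comp continuous_subtype_val).subtype_mk _)
  have hro (x : W) : ∃ g : G, g • (x : X) = r x := orbitMap_eq_iff.1 (hs.2 _)
  have hrs {x y : W} (hxy : orbitMap G X x = orbitMap G X y) : r x = r y := by
    simp only [r, hxy]
  have hA : IsOpen {x : W | r x = x} := by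
    -- As `r x` lies in the orbit of `x` and the action is free, `r x = x` amounts to finitely many
    -- inequalities, which are open conditions in a Hausdorff space.
    have : {x : W | r x = x} = ⋂ g : {g : G // g ≠ 1}, {x : W | r x ≠ g.1 • (x : X)} := by
      ext x
      simp only [mem_ofPred_eq, mem_iInter, Subtype.forall]
      constructor
      · intro hx g hg hgx
        exact hg (hfree g x (by rw [← hgx, hx]))
      · intro hx
        obtain ⟨g, hg⟩ := hro x
        by_cases h1 : g = 1
        · rw [← hg, h1, one_smul]
        · exact absurd hg.symm (hx g h1)
    rw [this]
    refine isOpen_iInter_of_finite fun g => ?_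
    exact isOpen_ne_fun hr (continuous_subtype_val.const_smul g.1)
  refine ⟨Subtype.val '' {x : W | r x = x}, ⟨hW.isOpenMap_subtype_val _ hA, ?_⟩, ?_⟩
  · rintro _ ⟨x, hx, rfl⟩ g ⟨y, hy, hyx⟩
    have : r y = r x := hrs (orbitMap_eq_iff.2 ⟨g, hyx.symm⟩)
    refine hfree g x ?_
    rw [← hyx, ← hy, this, hx]
  · ext b
    constructor
    · rintro ⟨_, ⟨x, -, rfl⟩, rfl⟩
      exact x.2
    · intro hb
      have hsb : orbitMap G X (s ⟨b, hb⟩) = b := hs.2 ⟨b, hb⟩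
      refine ⟨s ⟨b, hb⟩, ⟨⟨s ⟨b, hb⟩, ?_⟩, ?_, rfl⟩, hsb⟩
      · change orbitMap G X _ ∈ U
        rwa [hsb]
      · simp only [mem_ofPred_eq, r]
        congr 2

/-- A free action of a finite group on a Hausdorff space has slices at all points. -/
theorem exists_isOpenSlice_mem [Finite G] [T2Space X] (hfree : IsFreeAction G X) (x : X) :
    ∃ A : Set X, IsOpenSlice G A ∧ x ∈ A := by
  have hsep (g : {g : G // g ≠ 1}) : ∃ W : Set X, IsOpen W ∧ x ∈ W ∧
      ∀ a ∈ W, g.1 • a ∉ W := by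
    have hne : g.1 • x ≠ x := fun h => g.2 (hfree _ _ h)
    obtain ⟨P, Q, hP, hQ, hxP, hxQ, hPQ⟩ := t2_separation hne
    refine ⟨(fun y => g.1 • y) ⁻¹' P ∩ Q, (hP.preimage (continuous_const_smul _)).inter hQ,
      ⟨hxP, hxQ⟩, fun a ha hga => ?_⟩
    exact disjoint_left.1 hPQ ha.1 hga.2
  choose W hWo hxW hW using hsep
  refine ⟨⋂ g, W g, ⟨isOpen_iInter_of_finite hWo, fun a ha g hga => ?_⟩, mem_iInter.2 hxW⟩
  by_contra hg
  exact hW ⟨g, hg⟩ a (mem_iInter.1 ha _) (mem_iInter.1 hga _)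

theorem exists_isSectionalCover_orbitMap [Finite G] [T2Space X] (hfree : IsFreeAction G X) :
    ∃ 𝒰, IsSectionalCover (orbitMap G X) 𝒰 := by
  refine ⟨{U | ∃ A : Set X, IsOpenSlice G A ∧ orbitMap G X '' A = U}, ?_, ?_, ?_⟩
  · rintro _ ⟨A, hA, rfl⟩
    exact isOpenMap_orbitMap _ hA.1
  · rw [sUnion_eq_univ_iff]
    rintro ⟨x⟩
    obtain ⟨A, hA, hx⟩ := exists_isOpenSlice_mem hfree x
    exact ⟨_, ⟨A, hA, rfl⟩, x, hx, rfl⟩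
  · rintro _ ⟨A, hA, rfl⟩
    exact hA.exists_isLocalSection

/-- Some sectional cover exists, so the infimum in `secat` is attained. For `n = ⊤` the cover may be
infinite. -/
theorem exists_isSectionalCover_encard_le [Finite G] [T2Space X] (hfree : IsFreeAction G X)
    {n : ℕ∞} (hn : secatOrbit G X ≤ n) :
    ∃ 𝒰, IsSectionalCover (orbitMap G X) 𝒰 ∧ 𝒰.encard ≤ n := by
  obtain ⟨𝒱, h𝒱⟩ := exists_isSectionalCover_orbitMap hfree
  obtain ⟨𝒰, h𝒰, hcard⟩ := csInf_mem (s := {n : ℕ∞ | ∃ 𝒰, IsSectionalCover (orbitMap G X) 𝒰 ∧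
    𝒰.encard = n}) ⟨_, 𝒱, h𝒱, rfl⟩
  exact ⟨𝒰, h𝒰, hcard.trans_le hn⟩

/-- Sectional category of orbit maps is monotone along equivariant maps of free spaces. -/
theorem secatOrbit_le_of_equivariant {Z : Type*} [TopologicalSpace Z] [MulAction G Z]
    [ContinuousConstSMul G Z] [Finite G] [T2Space Z] (hfreeZ : IsFreeAction G Z)
    {φ : X → Z} (hφ : Continuous φ) (hequiv : ∀ (g : G) x, φ (g • x) = g • φ x) :
    secatOrbit G X ≤ secatOrbit G Z := by
  refine le_sInf ?_
  rintro _ ⟨𝒰, h𝒰, rfl⟩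
  have hslice (U : 𝒰) : ∃ A : Set Z, IsOpenSlice G A ∧ orbitMap G Z '' A = U := by
    obtain ⟨s, hs⟩ := h𝒰.2.2 U U.2
    exact hs.exists_isOpenSlice hfreeZ (h𝒰.1 U U.2)
  choose A hA hAU using hslice
  have hB (U : 𝒰) : IsOpenSlice G (φ ⁻¹' A U) :=
    ⟨(hA U).1.preimage hφ, fun a ha g hga => (hA U).2 _ ha g (by rw [← hequiv]; exact hga)⟩
  have hcover : IsSectionalCover (orbitMap G X)
      (range fun U : 𝒰 => orbitMap G X '' (φ ⁻¹' A U)) := by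
    refine ⟨?_, ?_, ?_⟩
    · rintro _ ⟨U, rfl⟩
      exact isOpenMap_orbitMap _ (hB U).1
    · rw [sUnion_eq_univ_iff]
      rintro ⟨x⟩
      obtain ⟨U, hU, hxU⟩ := sUnion_eq_univ_iff.1 h𝒰.2.1 (orbitMap G Z (φ x))
      obtain ⟨a, ha, hax⟩ := (hAU ⟨U, hU⟩).symm.subset hxU
      obtain ⟨g, rfl⟩ := orbitMap_eq_iff.1 hax
      refine ⟨_, ⟨⟨U, hU⟩, rfl⟩, g • x, ?_, orbitMap_eq_iff.2 ⟨g, rfl⟩⟩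
      rwa [mem_preimage, hequiv]
    · rintro _ ⟨U, rfl⟩
      exact (hB U).exists_isLocalSection
  have hle : secatOrbit G X ≤ _ := sInf_le ⟨_, hcover, rfl⟩
  refine hle.trans ?_
  rw [← image_univ]
  exact (encard_image_le _ _).trans_eq (encard_univ _)

end Slices

/-! ### The configuration-like space and its equivariant maps -/

section ConfSpace

theorem ConfSpace.continuous_apply {G Y : Type*} [TopologicalSpace Y] {ℓ : ℕ} (h : G ≃ Fin ℓ)
    (q : ℕ) (j : Fin ℓ) : Continuous fun y : ConfSpace h Y q => y.1 j :=
  (_root_.continuous_apply j).comp (continuous_subtype_val (p := (· ∈ confSet Y ℓ q)))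

theorem ConfSpace.exists_ne {G Y : Type*} {ℓ : ℕ} {h : G ≃ Fin ℓ} {q : ℕ} (y : ConfSpace h Y q) {u : Fin q → G}
    (hu : Function.Injective u) : ∃ i j, y.1 (h (u i)) ≠ y.1 (h (u j)) := by
  obtain ⟨a, ha, b, hb, hab⟩ := y.2 (Finset.univ.map ⟨fun i => h (u i), h.injective.comp hu⟩)
    (by simp)
  obtain ⟨i, -, rfl⟩ := Finset.mem_map.1 ha
  obtain ⟨j, -, rfl⟩ := Finset.mem_map.1 hb
  exact ⟨i, j, hab⟩

variable {G Y : Type*} [Group G] {ℓ : ℕ} (h : G ≃ Fin ℓ) (q : ℕ)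

theorem ConfSpace.smul_val (g : G) (y : ConfSpace h Y q) (j : Fin ℓ) :
    (g • y).1 j = y.1 (h (g⁻¹ * h.symm j)) := rfl

/-- A point fixed by `g` has equal coordinates along all powers of `g`. If `g ≠ 1`, then `q ≤
ℓ.minFac ≤ orderOf g`, so `q` of these powers are distinct, which is excluded. -/
theorem ConfSpace.isFreeAction (hqe : q ≤ ℓ.minFac) : IsFreeAction G (ConfSpace h Y q) := by
  intro g y hy
  by_contra hg
  have : Finite G := Finite.of_equiv _ h.symm
  have hcard : Nat.card G = ℓ := by rw [Nat.card_congr h, Nat.card_fin]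
  have hord : q ≤ orderOf g := hqe.trans
    (Nat.minFac_le_of_dvd (by
      have := orderOf_pos g
      have : orderOf g ≠ 1 := fun h => hg (orderOf_eq_one_iff.1 h)
      omega) (hcard ▸ orderOf_dvd_natCard g))
  have hconst (k : ℕ) : y.1 (h (g ^ k)) = y.1 (h 1) := by
    induction k with
    | zero => simp
    | succ k ih =>
      rw [← ih]
      conv_lhs => rw [← hy]
      rw [ConfSpace.smul_val]
      simp [pow_succ']
  obtain ⟨i, j, hij⟩ := y.exists_ne (u := fun i : Fin q => g ^ (i : ℕ)) (fun i j hij =>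
    Fin.ext (pow_injOn_Iio_orderOf (i.2.trans_le hord) (j.2.trans_le hord) hij))
  exact hij ((hconst i).trans (hconst j).symm)

variable [TopologicalSpace Y]

instance [T2Space Y] : T2Space (ConfSpace h Y q) :=
  inferInstanceAs (T2Space (confSet Y ℓ q))

instance : ContinuousConstSMul G (ConfSpace h Y q) where
  continuous_const_smul _ := Continuous.subtype_mk (p := (· ∈ confSet Y ℓ q))
    (continuous_pi fun _ => ConfSpace.continuous_apply h q _) _

/-- An equivariant `φ` is determined by its coordinate at the identity, since the coordinate of `φ
x` at `g` is that of `φ (g⁻¹ x)` at `1`. This coordinate plays the role of `f`. -/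
theorem hasBUP_iff_not_exists_equivariant {X : Type*} [TopologicalSpace X] [MulAction G X]
    [ContinuousConstSMul G X] :
    HasBUP X G Y q ↔ ¬ ∃ φ : X → ConfSpace h Y q, Continuous φ ∧
      ∀ (g : G) x, φ (g • x) = g • φ x := by
  constructor
  · rintro hB ⟨φ, hφ, hequiv⟩
    obtain ⟨x, u, hu, hux⟩ := hB ⟨fun x => (φ x).1 (h 1),
      (ConfSpace.continuous_apply h q (h 1)).comp hφ⟩
    obtain ⟨i, j, hij⟩ := (φ x).exists_ne (u := fun i => (u i)⁻¹) (inv_injective.comp hu)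
    refine hij ?_
    simpa [hequiv, ConfSpace.smul_val] using hux i j
  · intro hno f
    by_contra! hf
    refine hno ⟨fun x => ⟨fun j => f ((h.symm j)⁻¹ • x), fun S hS => ?_⟩, ?_, fun g x => ?_⟩
    · obtain ⟨i, j, hij⟩ := hf x (fun i => (h.symm (S.equivFinOfCardEq hS |>.symm i))⁻¹)
        (inv_injective.comp (h.symm.injective.comp
          (Subtype.val_injective.comp (Equiv.injective _))))
      exact ⟨_, Subtype.property _, _, Subtype.property _, hij⟩
    · exact Continuous.subtype_mk (p := (· ∈ confSet Y ℓ q))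
        (continuous_pi fun j => f.continuous.comp (continuous_const_smul _)) _
    · refine Subtype.ext (funext fun j => ?_)
      change f ((h.symm j)⁻¹ • g • x) = f ((h.symm (h (g⁻¹ * h.symm j)))⁻¹ • x)
      simp [mul_smul]

end ConfSpace

/-! ### Extending maps from the boundary of a simplex -/

section Simplices

/-- The geometric simplex spanned by a finite set of vertices. -/
def geomSimplex {V : Type*} (σ : Finset V) : Set (V → ℝ) :=
  {t | (∀ v, 0 ≤ t v) ∧ (∀ v, v ∉ σ → t v = 0) ∧ ∑ v ∈ σ, t v = 1}

variable {V : Type*}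

theorem isClosed_geomSimplex (σ : Finset V) : IsClosed (geomSimplex σ) := by
  have h₁ : IsClosed {t : V → ℝ | ∀ v, 0 ≤ t v} := by
    simp only [ofPred_forall]
    exact isClosed_iInter fun v => isClosed_le continuous_const (continuous_apply v)
  have h₂ : IsClosed {t : V → ℝ | ∀ v, v ∉ σ → t v = 0} := by
    simp only [ofPred_forall]
    exact isClosed_iInter fun v => isClosed_iInter fun _ =>
      isClosed_eq (continuous_apply v) continuous_const
  exact h₁.inter (h₂.inter
    (isClosed_eq (continuous_finsetSum _ fun v _ => continuous_apply v) continuous_const))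

theorem mem_geomSimplex_erase [DecidableEq V] {σ : Finset V} {t : V → ℝ} {v : V}
    (ht : t ∈ geomSimplex σ) (hv : t v = 0) : t ∈ geomSimplex (σ.erase v) := by
  refine ⟨ht.1, fun w hw => ?_, ?_⟩
  · by_cases h : w = v
    · rw [h, hv]
    · exact ht.2.1 w fun hσ => hw (Finset.mem_erase.2 ⟨h, hσ⟩)
  · rw [Finset.sum_erase _ hv, ht.2.2]

/-- The union of the proper faces of a simplex. -/
def geomBoundary (σ : Finset V) : Set (V → ℝ) :=
  {t | t ∈ geomSimplex σ ∧ ∃ v ∈ σ, t v = 0}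

/-- Maps of the `(d - 1)`-sphere to `Z` extend to the `d`-ball. -/
def ExtendsSphereMaps (d : ℕ) (Z : Type*) [TopologicalSpace Z] : Prop :=
  ∀ f : C(Metric.sphere (0 : EuclideanSpace ℝ (Fin d)) 1, Z),
    ∃ F : C(Metric.closedBall (0 : EuclideanSpace ℝ (Fin d)) 1, Z),
      ∀ x : Metric.sphere (0 : EuclideanSpace ℝ (Fin d)) 1,
        F ⟨x, Metric.sphere_subset_closedBall x.2⟩ = f x

/-- The solid simplex with vertices the origin and the standard basis vectors. -/
def cornerSimplex (d : ℕ) : Set (EuclideanSpace ℝ (Fin d)) :=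
  {x | (∀ i, 0 ≤ x i) ∧ ∑ i, x i ≤ 1}

theorem isClosed_cornerSimplex (d : ℕ) : IsClosed (cornerSimplex d) := by
  have h₁ : IsClosed {x : EuclideanSpace ℝ (Fin d) | ∀ i, 0 ≤ x i} := by
    simp only [ofPred_forall]
    exact isClosed_iInter fun i => isClosed_le continuous_const (by fun_prop)
  have h₂ : IsClosed {x : EuclideanSpace ℝ (Fin d) | ∑ i, x i ≤ 1} :=
    isClosed_le (by fun_prop) continuous_const
  exact h₁.inter h₂

theorem convex_cornerSimplex (d : ℕ) : Convex ℝ (cornerSimplex d) := by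
  intro x hx y hy a b ha hb hab
  refine ⟨fun i => ?_, ?_⟩
  · have := mul_nonneg ha (hx.1 i)
    have := mul_nonneg hb (hy.1 i)
    simp only [PiLp.add_apply, PiLp.smul_apply, smul_eq_mul]
    linarith
  · simp only [PiLp.add_apply, PiLp.smul_apply, smul_eq_mul, Finset.sum_add_distrib,
      ← Finset.mul_sum]
    nlinarith [hx.2, hy.2]

theorem isBounded_cornerSimplex (d : ℕ) : Bornology.IsBounded (cornerSimplex d) := by
  rw [isBounded_iff_forall_norm_le]
  refine ⟨√d, fun x hx => ?_⟩
  rw [EuclideanSpace.norm_eq]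
  refine Real.sqrt_le_sqrt ?_
  have hle (i) : ‖x i‖ ^ 2 ≤ 1 := by
    have h1 : x i ≤ 1 := (Finset.single_le_sum (fun j _ => hx.1 j) (Finset.mem_univ i)).trans hx.2
    have h0 := hx.1 i
    rw [Real.norm_eq_abs, sq_abs]
    nlinarith
  calc ∑ i, ‖x i‖ ^ 2 ≤ ∑ _i : Fin d, (1 : ℝ) := Finset.sum_le_sum fun i _ => hle i
    _ = d := by simp

theorem interior_cornerSimplex (d : ℕ) :
    interior (cornerSimplex d) = {x | (∀ i, 0 < x i) ∧ ∑ i, x i < 1} := by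
  apply subset_antisymm
  · intro x hx
    -- An interior point can be moved slightly in every direction. Moving it against a coordinate,
    -- or along one, makes the defining inequalities strict.
    have hmem (v : EuclideanSpace ℝ (Fin d)) : ∃ ε > (0 : ℝ), x + ε • v ∈ cornerSimplex d := by
      have hc : Filter.Tendsto (fun ε : ℝ => x + ε • v) (nhdsWithin 0 (Ioi 0)) (nhds x) := by
        have : Continuous fun ε : ℝ => x + ε • v := by fun_prop
        have := (this.tendsto 0).mono_left (nhdsWithin_le_nhds (s := Ioi 0))
        simpa using this
      obtain ⟨ε, h1, h2⟩ := ((hc.eventually (mem_interior_iff_mem_nhds.1 hx)).and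
        self_mem_nhdsWithin).exists
      exact ⟨ε, h2, h1⟩
    have hx' := interior_subset hx
    have hpos (i) : 0 < x i := by
      obtain ⟨ε, hε, h⟩ := hmem (-EuclideanSpace.single i 1)
      have := h.1 i
      simp at this
      linarith
    refine ⟨hpos, ?_⟩
    rcases Nat.eq_zero_or_pos d with rfl | hd
    · simp
    · obtain ⟨ε, hε, h⟩ := hmem (EuclideanSpace.single ⟨0, hd⟩ 1)
      have := h.2
      simp [Finset.sum_add_distrib] at this
      linarith
  · have h₁ : IsOpen {x : EuclideanSpace ℝ (Fin d) | ∀ i, 0 < x i} := by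
      simp only [ofPred_forall]
      exact isOpen_iInter_of_finite fun i => isOpen_lt continuous_const (by fun_prop)
    have h₂ : IsOpen {x : EuclideanSpace ℝ (Fin d) | ∑ i, x i < 1} :=
      isOpen_lt (by fun_prop) continuous_const
    exact interior_maximal (fun x hx => ⟨fun i => (hx.1 i).le, hx.2.le⟩) (h₁.inter h₂)

theorem frontier_cornerSimplex (d : ℕ) : frontier (cornerSimplex d) =
    {x | x ∈ cornerSimplex d ∧ ((∃ i, x i = 0) ∨ ∑ i, x i = 1)} := by
  rw [(isClosed_cornerSimplex d).frontier_eq, interior_cornerSimplex]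
  ext x
  constructor
  · rintro ⟨hx, hn⟩
    refine ⟨hx, ?_⟩
    by_contra! hc
    exact hn ⟨fun i => (hx.1 i).lt_of_ne' (hc.1 i), hx.2.lt_of_ne hc.2⟩
  · rintro ⟨hx, ⟨i, hi⟩ | hs⟩
    · exact ⟨hx, fun h => (h.1 i).ne' hi⟩
    · exact ⟨hx, fun h => h.2.ne hs⟩

theorem interior_cornerSimplex_nonempty (d : ℕ) : (interior (cornerSimplex d)).Nonempty := by
  rw [interior_cornerSimplex]
  refine ⟨WithLp.toLp 2 fun _ => ((d : ℝ) + 1)⁻¹, fun i => ?_, ?_⟩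
  · simp only; positivity
  · simp only [Finset.sum_const, Finset.card_univ, Fintype.card_fin, nsmul_eq_mul]
    rw [← div_eq_mul_inv, div_lt_one (by positivity)]
    linarith

/-- A space to which sphere maps extend over the ball also admits extensions of maps on the
boundary of a solid simplex. -/
theorem ExtendsSphereMaps.exists_extend_corner {d : ℕ} {Z : Type*} [TopologicalSpace Z]
    (hE : ExtendsSphereMaps d Z) {f : EuclideanSpace ℝ (Fin d) → Z}
    (hf : ContinuousOn f (frontier (cornerSimplex d))) :
    ∃ F : EuclideanSpace ℝ (Fin d) → Z, ContinuousOn F (cornerSimplex d) ∧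
      EqOn F f (frontier (cornerSimplex d)) := by
  obtain ⟨h, -, hcl, hfr⟩ := exists_homeomorph_image_interior_closure_frontier_eq_unitBall
    (convex_cornerSimplex d) (interior_cornerSimplex_nonempty d) (isBounded_cornerSimplex d)
  rw [(isClosed_cornerSimplex d).closure_eq] at hcl
  have hsymm (y : Metric.sphere (0 : EuclideanSpace ℝ (Fin d)) 1) :
      h.symm y ∈ frontier (cornerSimplex d) := by
    obtain ⟨x, hx, hxy⟩ := hfr.symm.subset y.2
    rwa [← hxy, h.symm_apply_apply]
  obtain ⟨F, hF⟩ := hE ⟨fun y => f (h.symm y), hf.comp_continuous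
    (h.symm.continuous.comp continuous_subtype_val) hsymm⟩
  obtain ⟨x₀, -⟩ := interior_cornerSimplex_nonempty d
  have : Nonempty Z := ⟨F ⟨0, by simp⟩⟩
  classical
  -- The value outside the ball is irrelevant, since `h` maps the simplex onto the ball.
  let F' : EuclideanSpace ℝ (Fin d) → Z := fun x =>
    if hx : h x ∈ Metric.closedBall 0 1 then F ⟨h x, hx⟩ else Classical.arbitrary Z
  have hF' {x} (hx : h x ∈ Metric.closedBall 0 1) : F' x = F ⟨h x, hx⟩ := dif_pos hx
  refine ⟨F', ?_, fun x hx => ?_⟩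
  · rw [continuousOn_iff_continuous_domRestrict]
    have hmem (x : cornerSimplex d) : h x ∈ Metric.closedBall (0 : EuclideanSpace ℝ (Fin d)) 1 :=
      hcl.subset (mem_image_of_mem _ x.2)
    refine (F.continuous.comp ((h.continuous.comp continuous_subtype_val).subtype_mk hmem)).congr
      fun x => ?_
    exact (hF' (hmem x)).symm
  · have hs : h x ∈ Metric.sphere (0 : EuclideanSpace ℝ (Fin d)) 1 :=
      hfr.subset (mem_image_of_mem _ hx)
    rw [hF' (Metric.sphere_subset_closedBall hs), hF ⟨h x, hs⟩]
    simp

/-- Forgetting the coordinate at one vertex `v₀` identifies the simplex with the corner simplex and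
matches their boundaries; the forgotten coordinate is recovered as `1 - ∑ i, x i`. -/
theorem ExtendsSphereMaps.exists_extend_simplex {d : ℕ} {Z : Type*} [TopologicalSpace Z]
    (hE : ExtendsSphereMaps d Z) {σ : Finset V} (hσ : σ.card = d + 1) {c : (V → ℝ) → Z}
    (hc : ContinuousOn c (geomBoundary σ)) :
    ∃ F : (V → ℝ) → Z, ContinuousOn F (geomSimplex σ) ∧ EqOn F c (geomBoundary σ) := by
  classical
  obtain ⟨v₀, τ, hv₀, rfl, hτ⟩ := Finset.card_eq_succ.1 hσ
  let e : Fin d ≃ τ := (τ.equivFinOfCardEq hτ).symm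
  have hne (i) : (e i : V) ≠ v₀ := fun h => hv₀ (h ▸ (e i).2)
  have hsum (t : V → ℝ) : ∑ i, t (e i) = ∑ v ∈ τ, t v := by
    rw [e.sum_comp fun v : τ => t v, Finset.sum_coe_sort]
  let P : (V → ℝ) → EuclideanSpace ℝ (Fin d) := fun t => WithLp.toLp 2 fun i => t (e i)
  let Q : EuclideanSpace ℝ (Fin d) → V → ℝ := fun x v =>
    if v = v₀ then 1 - ∑ i, x i else if hv : v ∈ τ then x (e.symm ⟨v, hv⟩) else 0
  have hQ₀ (x) : Q x v₀ = 1 - ∑ i, x i := if_pos rfl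
  have hQe (x) (i) : Q x (e i) = x i := by simp [Q, hne]
  have hQτ (x) {v} (h1 : v ≠ v₀) (h2 : v ∉ τ) : Q x v = 0 := by simp [Q, h1, h2]
  have hPc : Continuous P := by fun_prop
  have hQc : Continuous Q := by
    refine continuous_pi fun v => ?_
    by_cases h1 : v = v₀
    · subst h1; simp only [hQ₀]; fun_prop
    · by_cases h2 : v ∈ τ
      · obtain ⟨i, hi⟩ := e.surjective ⟨v, h2⟩
        have : v = e i := by rw [hi]
        subst this; simp only [hQe]; fun_prop
      · simp only [hQτ _ h1 h2]; fun_prop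
  have hQmem {x} (hx : x ∈ cornerSimplex d) : Q x ∈ geomSimplex (insert v₀ τ) := by
    refine ⟨fun v => ?_, fun v hv => ?_, ?_⟩
    · by_cases h1 : v = v₀
      · subst h1; rw [hQ₀]; linarith [hx.2]
      · by_cases h2 : v ∈ τ
        · have := hx.1 (e.symm ⟨v, h2⟩)
          simpa [Q, h1, h2] using this
        · rw [hQτ _ h1 h2]
    · rw [Finset.mem_insert, not_or] at hv
      exact hQτ _ hv.1 hv.2
    · rw [Finset.sum_insert hv₀, hQ₀, ← hsum]
      simp [hQe]
  have hPmem {t} (ht : t ∈ geomSimplex (insert v₀ τ)) :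
      P t ∈ cornerSimplex d ∧ ∑ i, P t i = 1 - t v₀ := by
    have h1 := ht.2.2
    rw [Finset.sum_insert hv₀, ← hsum] at h1
    have h2 : ∑ i, P t i = 1 - t v₀ := by simp only [P]; linarith
    exact ⟨⟨fun i => ht.1 _, by linarith [ht.1 v₀]⟩, h2⟩
  have hQP {t} (ht : t ∈ geomSimplex (insert v₀ τ)) : Q (P t) = t := by
    funext v
    by_cases h1 : v = v₀
    · subst h1; rw [hQ₀, (hPmem ht).2]; ring
    · by_cases h2 : v ∈ τ
      · simp [Q, P, h1, h2]
      · rw [hQτ _ h1 h2, ht.2.1 v (by simp [h1, h2])]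
  have hQfr : MapsTo Q (frontier (cornerSimplex d)) (geomBoundary (insert v₀ τ)) := by
    intro x hx
    rw [frontier_cornerSimplex] at hx
    refine ⟨hQmem hx.1, ?_⟩
    obtain ⟨i, hi⟩ | hs := hx.2
    · exact ⟨e i, by simp, by rw [hQe, hi]⟩
    · exact ⟨v₀, by simp, by rw [hQ₀, hs, sub_self]⟩
  have hPfr : MapsTo P (geomBoundary (insert v₀ τ)) (frontier (cornerSimplex d)) := by
    rintro t ⟨ht, v, hv, htv⟩
    rw [frontier_cornerSimplex]
    refine ⟨(hPmem ht).1, ?_⟩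
    obtain rfl | hv := Finset.mem_insert.1 hv
    · right; rw [(hPmem ht).2, htv, sub_zero]
    · left; exact ⟨e.symm ⟨v, hv⟩, by simp [P, htv]⟩
  obtain ⟨F, hFc, hFe⟩ := hE.exists_extend_corner (hc.comp hQc.continuousOn hQfr)
  refine ⟨F ∘ P, hFc.comp hPc.continuousOn fun t ht => (hPmem ht).1, fun t ht => ?_⟩
  rw [Function.comp_apply, hFe (hPfr ht), Function.comp_apply, hQP ht.1]

/-- The boundary is covered by finitely many closed facets. -/
theorem continuousOn_geomBoundary {Z : Type*} [TopologicalSpace Z] [DecidableEq V]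
    {σ : Finset V} {c : (V → ℝ) → Z}
    (hc : ∀ v ∈ σ, ContinuousOn c (geomSimplex (σ.erase v))) :
    ContinuousOn c (geomBoundary σ) := by
  refine ((locallyFinite_of_finite fun v : σ => geomSimplex (σ.erase v)).continuousOn_iUnion
    (fun v => isClosed_geomSimplex _) fun v => hc v v.2).mono ?_
  rintro t ⟨ht, v, hv, htv⟩
  exact mem_iUnion.2 ⟨⟨v, hv⟩, mem_geomSimplex_erase ht htv⟩

end Simplices

/-! ### Equivariant maps out of free complexes -/

section Skeleta

open scoped Pointwise

variable {G V : Type*} [Group G] [MulAction G V]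

/-- The action of a group on barycentric coordinates. -/
def translateCoord (g : G) (t : V → ℝ) : V → ℝ := fun v => t (g⁻¹ • v)

theorem continuous_translateCoord (g : G) : Continuous (translateCoord (V := V) g) :=
  continuous_pi fun _ => continuous_apply _

theorem translateCoord_mul (g k : G) (t : V → ℝ) :
    translateCoord (g * k) t = translateCoord g (translateCoord k t) := by
  funext v
  simp [translateCoord, mul_smul]

variable [DecidableEq V]

theorem translateCoord_mem (g : G) {σ : Finset V} {t : V → ℝ} (ht : t ∈ geomSimplex σ) :
    translateCoord g t ∈ geomSimplex (g • σ) := by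
  refine ⟨fun v => ht.1 _, fun v hv => ht.2.1 _ fun h => hv ?_, ?_⟩
  · exact Finset.inv_smul_mem_iff.1 h
  · rw [← ht.2.2, ← Finset.image_smul, Finset.sum_image fun _ _ _ _ h => MulAction.injective g h]
    simp [translateCoord]

theorem translateCoord_mem_boundary (g : G) {σ : Finset V} {t : V → ℝ}
    (ht : t ∈ geomBoundary σ) : translateCoord g t ∈ geomBoundary (g • σ) := by
  obtain ⟨hs, v, hv, htv⟩ := ht
  exact ⟨translateCoord_mem g hs, g • v, Finset.smul_mem_smul_finset hv, by
    simpa [translateCoord] using htv⟩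

/-- An abstract simplicial complex, given by its finite sets of vertices, on which the group `G`
acts freely. -/
structure IsFreeComplex (G : Type*) {V : Type*} [Group G] [MulAction G V] [DecidableEq V]
    (K : Set (Finset V)) : Prop where
  mono : ∀ σ ∈ K, ∀ τ ⊆ σ, τ ∈ K
  smul_mem : ∀ (g : G), ∀ σ ∈ K, g • σ ∈ K
  free : ∀ σ ∈ K, σ.Nonempty → ∀ g : G, g • σ = σ → g = 1

variable {Z : Type*} [TopologicalSpace Z] [MulAction G Z]

variable (G) in
/-- The function `c` restricts to a continuous equivariant map on the simplices of `K` with at most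
`k` vertices. -/
def IsEquivariantOnSkeleton (K : Set (Finset V)) (k : ℕ) (c : (V → ℝ) → Z) : Prop :=
  ∀ σ ∈ K, σ.card ≤ k → ContinuousOn c (geomSimplex σ) ∧
    ∀ g : G, ∀ t ∈ geomSimplex σ, c (translateCoord g t) = g • c t

variable [ContinuousConstSMul G Z]

/-- Simplices have trivial stabilizers, so an extension can be chosen freely on one simplex per
orbit and carried to the others by the group. The pieces agree on boundaries because `c` is already
equivariant there. -/
theorem IsFreeComplex.exists_extend_skeleton [Nonempty Z] {K : Set (Finset V)} (hK : IsFreeComplex G K) {k : ℕ}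
    (hE : ∀ σ ∈ K, σ.card = k + 1 → ExtendsSphereMaps k Z) {c : (V → ℝ) → Z}
    (hc : IsEquivariantOnSkeleton G K k c) :
    ∃ c' : (V → ℝ) → Z, IsEquivariantOnSkeleton G K (k + 1) c' ∧
      ∀ σ ∈ K, σ.card ≤ k → EqOn c' c (geomSimplex σ) := by
  classical
  have hext (σ : Finset V) (hσ : σ ∈ K ∧ σ.card = k + 1) : ∃ F : (V → ℝ) → Z,
      ContinuousOn F (geomSimplex σ) ∧ EqOn F c (geomBoundary σ) :=
    (hE σ hσ.1 hσ.2).exists_extend_simplex hσ.2 (continuousOn_geomBoundary fun v hv =>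
      (hc _ (hK.mono σ hσ.1 _ (Finset.erase_subset _ _))
        (by rw [Finset.card_erase_of_mem hv, hσ.2]; simp)).1)
  choose! e hec heb using hext
  let r : Finset V → Finset V := fun σ =>
    (Quotient.mk (MulAction.orbitRel G (Finset V)) σ).out
  have hr (σ : Finset V) : ∃ g : G, g • r σ = σ :=
    MulAction.orbitRel_apply.1 ((MulAction.orbitRel G (Finset V)).symm
      (Quotient.exact (Quotient.out_eq (Quotient.mk (MulAction.orbitRel G (Finset V)) σ))))
  have hrsmul (g : G) (σ : Finset V) : r (g • σ) = r σ := by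
    simp only [r]
    congr 1
    exact Quotient.sound (MulAction.orbitRel_apply.2 ⟨g, rfl⟩)
  choose γ hγ using hr
  have hrinv (σ : Finset V) : (γ σ)⁻¹ • σ = r σ := by rw [inv_smul_eq_iff, hγ]
  have hrK {σ} (hσ : σ ∈ K ∧ σ.card = k + 1) : r σ ∈ K ∧ (r σ).card = k + 1 := by
    rw [← hrinv]
    exact ⟨hK.smul_mem _ _ hσ.1, by rw [Finset.card_smul_finset, hσ.2]⟩
  -- Freeness makes the element carrying `r σ` to `σ` unique, hence equivariant in `σ`.
  have hγsmul (g : G) {σ} (hσ : σ ∈ K ∧ σ.card = k + 1) : γ (g • σ) = g * γ σ := by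
    have h1 : ((g * γ σ)⁻¹ * γ (g • σ)) • r σ = r σ := by
      rw [mul_smul, ← hrsmul g, hγ, inv_smul_eq_iff, mul_smul, hrsmul, hγ]
    have h2 := hK.free (r σ) (hrK hσ).1 (Finset.card_pos.1 (by rw [(hrK hσ).2]; omega)) _ h1
    rw [inv_mul_eq_one] at h2
    exact h2.symm
  let E : Finset V → (V → ℝ) → Z := fun σ t => γ σ • e (r σ) (translateCoord (γ σ)⁻¹ t)
  have hEc {σ} (hσ : σ ∈ K ∧ σ.card = k + 1) : ContinuousOn (E σ) (geomSimplex σ) := by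
    refine ContinuousOn.const_smul ((hec _ (hrK hσ)).comp
      (continuous_translateCoord _).continuousOn fun t ht => ?_) _
    rw [← hrinv]
    exact translateCoord_mem _ ht
  have hEb {σ} (hσ : σ ∈ K ∧ σ.card = k + 1) : EqOn (E σ) c (geomBoundary σ) := by
    intro t ht
    have h1 := translateCoord_mem_boundary (γ σ)⁻¹ ht
    rw [hrinv] at h1
    obtain ⟨hts, v, hv, htv⟩ := ht
    have h2 := (hc _ (hK.mono σ hσ.1 _ (Finset.erase_subset v _))
      (by rw [Finset.card_erase_of_mem hv, hσ.2]; simp)).2 (γ σ)⁻¹ t (mem_geomSimplex_erase hts htv)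
    simp only [E]
    rw [heb _ (hrK hσ) h1, h2, smul_inv_smul]
  have hEsmul (g : G) {σ} (hσ : σ ∈ K ∧ σ.card = k + 1) (t : V → ℝ) :
      E (g • σ) (translateCoord g t) = g • E σ t := by
    simp only [E]
    rw [hγsmul g hσ, hrsmul, mul_smul, ← translateCoord_mul]
    simp
  -- `P t σ` says that `t` is in the relative interior of the new simplex `σ`; this determines `σ`
  -- as the support of `t`.
  let P : (V → ℝ) → Finset V → Prop := fun t σ =>
    (σ ∈ K ∧ σ.card = k + 1) ∧ t ∈ geomSimplex σ ∧ ∀ v ∈ σ, t v ≠ 0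
  let c' : (V → ℝ) → Z := fun t => if h : ∃ σ, P t σ then E h.choose t else c t
  have hPuniq {t σ τ} (h₁ : P t σ) (h₂ : P t τ) : σ ⊆ τ := fun v hv => by
    by_contra hvτ
    exact h₁.2.2 v hv (h₂.2.1.2.1 v hvτ)
  have hc'P {t σ} (h : P t σ) : c' t = E σ t := by
    have hex : ∃ σ, P t σ := ⟨σ, h⟩
    simp only [c', dif_pos hex]
    rw [(hPuniq hex.choose_spec h).antisymm (hPuniq h hex.choose_spec)]
  have hc'low {σ} (hσc : σ.card ≤ k) : EqOn c' c (geomSimplex σ) := by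
    intro t ht
    refine dif_neg ?_
    rintro ⟨τ, hτ⟩
    have : τ ⊆ σ := fun v hv => by
      by_contra hvσ
      exact hτ.2.2 v hv (ht.2.1 v hvσ)
    have := Finset.card_le_card this
    have := hτ.1.2
    omega
  have hc'top {σ} (hσ : σ ∈ K ∧ σ.card = k + 1) : EqOn c' (E σ) (geomSimplex σ) := by
    intro t ht
    by_cases h : ∀ v ∈ σ, t v ≠ 0
    · exact hc'P ⟨hσ, ht, h⟩
    · push Not at h
      obtain ⟨v, hv, htv⟩ := h
      rw [hEb hσ ⟨ht, v, hv, htv⟩]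
      exact hc'low (by rw [Finset.card_erase_of_mem hv, hσ.2]; simp) (mem_geomSimplex_erase ht htv)
  refine ⟨c', fun σ hσ hcard => ?_, fun σ _ hcard => hc'low hcard⟩
  rcases hcard.lt_or_eq with hlt | heq
  · have hle : σ.card ≤ k := by omega
    refine ⟨(hc σ hσ hle).1.congr (hc'low hle), fun g t ht => ?_⟩
    rw [hc'low hle ht, ← (hc σ hσ hle).2 g t ht]
    exact hc'low (by rwa [Finset.card_smul_finset]) (translateCoord_mem g ht)
  · refine ⟨(hEc ⟨hσ, heq⟩).congr (hc'top ⟨hσ, heq⟩), fun g t ht => ?_⟩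
    rw [hc'top ⟨hσ, heq⟩ ht, ← hEsmul g ⟨hσ, heq⟩ t]
    exact hc'top ⟨hK.smul_mem g σ hσ, by rwa [Finset.card_smul_finset]⟩ (translateCoord_mem g ht)

/-- An equivariant map from a free simplicial complex to a sufficiently connected `G`-space. -/
theorem IsFreeComplex.exists_equivariant [Nonempty Z] {K : Set (Finset V)}
    (hK : IsFreeComplex G K) (hE : ∀ σ ∈ K, ∀ d, σ.card = d + 1 → ExtendsSphereMaps d Z) :
    ∃ c : (V → ℝ) → Z, ∀ σ ∈ K, ContinuousOn c (geomSimplex σ) ∧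
      ∀ g : G, ∀ t ∈ geomSimplex σ, c (translateCoord g t) = g • c t := by
  classical
  have hstep (k : ℕ) (c : {c : (V → ℝ) → Z // IsEquivariantOnSkeleton G K k c}) :
      ∃ c' : {c : (V → ℝ) → Z // IsEquivariantOnSkeleton G K (k + 1) c},
        ∀ σ ∈ K, σ.card ≤ k → EqOn c'.1 c.1 (geomSimplex σ) := by
    obtain ⟨c', h1, h2⟩ := hK.exists_extend_skeleton (fun σ hσ h => hE σ hσ k h) c.2
    exact ⟨⟨c', h1⟩, h2⟩
  choose next hnext using hstep
  have hempty {σ : Finset V} (hσ : σ.card ≤ 0) {t : V → ℝ} (ht : t ∈ geomSimplex σ) : False := by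
    rw [Nat.le_zero, Finset.card_eq_zero] at hσ
    subst hσ
    simpa using ht.2.2
  let c₀ : {c : (V → ℝ) → Z // IsEquivariantOnSkeleton G K 0 c} :=
    ⟨fun _ => Classical.arbitrary Z, fun σ _ hσ =>
      ⟨continuousOn_const, fun _ _ ht => (hempty hσ ht).elim⟩⟩
  let c : ∀ k, {c : (V → ℝ) → Z // IsEquivariantOnSkeleton G K k c} :=
    fun k => Nat.rec c₀ (fun k c => next k c) k
  have hstable {σ} (hσ : σ ∈ K) (m : ℕ) :
      EqOn (c (σ.card + m)).1 (c σ.card).1 (geomSimplex σ) := by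
    induction m with
    | zero => exact fun _ _ => rfl
    | succ m ih => exact fun t ht => (hnext _ (c (σ.card + m)) σ hσ (by omega) ht).trans (ih ht)
  -- The stages stabilize on a simplex once its dimension is reached, so the limit at `t` is read
  -- off at the number of vertices of the smallest face containing `t`.
  let C : (V → ℝ) → Z := fun t => (c t.support.ncard).1 t
  have hC {σ} (hσ : σ ∈ K) : EqOn C (c σ.card).1 (geomSimplex σ) := by
    intro t ht
    have hsupp : t.support = ((σ.filter fun v => t v ≠ 0 : Finset V) : Set V) := by
      ext v
      simp only [Function.mem_support, Finset.coe_filter, mem_ofPred_eq]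
      exact ⟨fun h => ⟨by_contra fun hv => h (ht.2.1 v hv), h⟩, fun h => h.2⟩
    simp only [C]
    rw [hsupp, ncard_coe_finset]
    have hsub : (σ.filter fun v => t v ≠ 0) ⊆ σ := Finset.filter_subset _ _
    have ht' : t ∈ geomSimplex (σ.filter fun v => t v ≠ 0) := by
      refine ⟨ht.1, fun v hv => ?_, by rw [Finset.sum_filter_ne_zero, ht.2.2]⟩
      by_cases hvσ : v ∈ σ
      · simpa [hvσ] using hv
      · exact ht.2.1 v hvσ
    have := hstable (hK.mono σ hσ _ hsub) (σ.card - (σ.filter fun v => t v ≠ 0).card) ht'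
    rw [Nat.add_sub_cancel' (Finset.card_le_card hsub)] at this
    exact this.symm
  refine ⟨C, fun σ hσ => ⟨((c σ.card).2 σ hσ le_rfl).1.congr (hC hσ), fun g t ht => ?_⟩⟩
  rw [hC hσ ht, ← ((c σ.card).2 σ hσ le_rfl).2 g t ht, ← Finset.card_smul_finset g σ]
  exact hC (hK.smul_mem g σ hσ) (translateCoord_mem g ht)

end Skeleta

/-! ### Equivariant barycentric coordinates -/

section Coordinates

open scoped Pointwise

variable {G X V : Type*} [Group G] [TopologicalSpace X] [MulAction G X] [MulAction G V]

/-- A map given by locally finite barycentric coordinates in a complex, followed by a map that is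
continuous on each simplex, is continuous. -/
theorem continuous_comp_coordinates {Z : Type*} [TopologicalSpace Z] {K : Set (Finset V)}
    (hK : ∀ σ ∈ K, ∀ τ ⊆ σ, τ ∈ K) {c : (V → ℝ) → Z}
    (hc : ∀ σ ∈ K, ContinuousOn c (geomSimplex σ)) {l : X → V → ℝ} (hl : Continuous l)
    (hfin : LocallyFinite fun v => {x | l x v ≠ 0})
    (hlK : ∀ x, ∃ σ ∈ K, l x ∈ geomSimplex σ) : Continuous (c ∘ l) := by
  classical
  rw [continuous_iff_continuousAt]
  intro x
  obtain ⟨N, hN, hNfin⟩ := hfin x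
  -- Near `x` only finitely many coordinates are nonzero, so finitely many closed sets, the
  -- preimages of simplices on those vertices, cover a neighbourhood.
  have hcont : ContinuousOn (c ∘ l) (⋃ σ : {σ : Finset V // σ ⊆ hNfin.toFinset ∧ σ ∈ K},
      l ⁻¹' geomSimplex σ.1) := by
    have : Finite {σ : Finset V // σ ⊆ hNfin.toFinset ∧ σ ∈ K} :=
      Finite.of_injective (β := hNfin.toFinset.powerset)
        (fun σ => ⟨σ.1, Finset.mem_powerset.2 σ.2.1⟩) fun σ τ h => by
          simpa [Subtype.ext_iff] using h
    exact (locallyFinite_of_finite _).continuousOn_iUnion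
      (fun σ => (isClosed_geomSimplex _).preimage hl)
      fun σ => (hc _ σ.2.2).comp hl.continuousOn fun _ h => h
  refine hcont.continuousAt (Filter.mem_of_superset hN fun y hy => ?_)
  obtain ⟨σ, hσ, hyσ⟩ := hlK y
  have hsub : (σ.filter fun v => l y v ≠ 0) ⊆ σ := Finset.filter_subset _ _
  refine mem_iUnion.2 ⟨⟨σ.filter fun v => l y v ≠ 0, fun v hv => ?_, hK σ hσ _ hsub⟩, ?_⟩
  · rw [Finite.mem_toFinset]
    exact ⟨y, (Finset.mem_filter.1 hv).2, hy⟩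
  · refine ⟨hyσ.1, fun v hv => ?_, by rw [Finset.sum_filter_ne_zero, hyσ.2.2]⟩
    by_cases hvσ : v ∈ σ
    · simpa [hvσ] using hv
    · exact hyσ.2.1 v hvσ

/-- Equivariant barycentric coordinates subordinate to an equivariant open cover. -/
theorem exists_equivariant_coordinates [ContinuousConstSMul G X] [T2Space X] [ParacompactSpace X]
    [Finite G] (W : V → Set X) (hWo : ∀ v, IsOpen (W v)) (hW : ⋃ v, W v = univ)
    (hequiv : ∀ (g : G) v x, g • x ∈ W (g • v) → x ∈ W v) :
    ∃ l : X → V → ℝ, Continuous l ∧ (LocallyFinite fun v => {x | l x v ≠ 0}) ∧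
      (∀ (g : G) x, l (g • x) = translateCoord g (l x)) ∧ (∀ x v, 0 ≤ l x v) ∧
      (∀ x v, l x v ≠ 0 → x ∈ W v) ∧ ∀ x, ∑ᶠ v, l x v = 1 := by
  have := Fintype.ofFinite G
  obtain ⟨f, hf⟩ := PartitionOfUnity.exists_isSubordinate isClosed_univ W hWo hW.ge
  have hG : (0 : ℝ) < Fintype.card G := by exact_mod_cast Fintype.card_pos
  -- Averaging a partition of unity over the group makes it equivariant; the equivariance of the
  -- cover keeps it subordinate.
  let l : X → V → ℝ := fun x v => (Fintype.card G : ℝ)⁻¹ * ∑ g : G, f (g • v) (g • x)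
  have hne {x v} (h : l x v ≠ 0) : ∃ g : G, f (g • v) (g • x) ≠ 0 := by
    obtain ⟨g, -, hg⟩ := Finset.exists_ne_zero_of_sum_ne_zero (right_ne_zero_of_mul h)
    exact ⟨g, hg⟩
  have hfW {x v} (h : f v x ≠ 0) : x ∈ W v := hf v (subset_tsupport _ h)
  refine ⟨l, ?_, ?_, fun g x => ?_, fun x v => ?_, fun x v h => ?_, fun x => ?_⟩
  · refine continuous_pi fun v => continuous_const.mul (continuous_finsetSum _ fun g _ => ?_)
    exact (f (g • v)).continuous.comp (continuous_const_smul g)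
  · intro x
    have hx (g : G) : ∃ N ∈ nhds x, {v | ∃ y ∈ N, f (g • v) (g • y) ≠ 0}.Finite := by
      obtain ⟨N, hN, hfin⟩ := f.locallyFinite (g • x)
      refine ⟨(fun y => g • y) ⁻¹' N, (continuous_const_smul g).continuousAt hN,
        (hfin.preimage (MulAction.injective g).injOn).subset ?_⟩
      rintro v ⟨y, hy, hv⟩
      exact ⟨g • y, hv, hy⟩
    choose N hN hfin using hx
    refine ⟨⋂ g, N g, Filter.iInter_mem.2 hN, (finite_iUnion hfin).subset ?_⟩
    rintro v ⟨y, hv, hy⟩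
    obtain ⟨g, hg⟩ := hne hv
    exact mem_iUnion.2 ⟨g, y, mem_iInter.1 hy g, hg⟩
  · funext v
    simp only [l, translateCoord]
    congr 1
    refine Fintype.sum_equiv (Equiv.mulRight g) _ _ fun k => ?_
    simp [mul_smul]
  · exact mul_nonneg (inv_nonneg.2 hG.le) (Finset.sum_nonneg fun g _ => f.nonneg _ _)
  · obtain ⟨g, hg⟩ := hne h
    exact hequiv g v x (hfW hg)
  · have hfin (g : G) : (Function.support fun v => f (g • v) (g • x)).Finite :=
      (f.locallyFinite.point_finite (g • x)).preimage (MulAction.injective g).injOn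
    have hsum (g : G) : ∑ᶠ v, f (g • v) (g • x) = 1 := by
      exact (finsum_comp_equiv (MulAction.toPerm g) (f := fun v => f v (g • x))).trans
        (f.sum_eq_one (mem_univ _))
    simp only [l]
    rw [← mul_finsum, finsum_sum_comm _ _ fun g _ => hfin g]
    simp [hsum, hG.ne']

end Coordinates

/-! ### Equivariant maps from sectional covers -/

section Existence

open scoped Pointwise

variable {G X Z : Type*} [Group G] [Finite G] [TopologicalSpace X] [MulAction G X]
  [ContinuousConstSMul G X] [T2Space X] [ParacompactSpace X] [TopologicalSpace Z] [MulAction G Z]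
  [ContinuousConstSMul G Z]

/-- The join of copies of `G` indexed by `I`: simplices contain at most one vertex per copy. -/
theorem isFreeComplex_join (G I : Type*) [Group G] [DecidableEq (Σ _ : I, G)] :
    IsFreeComplex G {σ : Finset (Σ _ : I, G) | InjOn Sigma.fst (σ : Set (Σ _ : I, G))} where
  mono _ hσ _ hτ := InjOn.mono (Finset.coe_subset.2 hτ) hσ
  smul_mem g σ hσ := by
    intro _ ha _ hb hab
    obtain ⟨a, ha', rfl⟩ := Finset.mem_smul_finset.1 ha
    obtain ⟨b, hb', rfl⟩ := Finset.mem_smul_finset.1 hb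
    rw [hσ ha' hb' hab]
  free σ hσ hne g hg := by
    obtain ⟨⟨i, k⟩, ha⟩ := hne
    -- The translate of the vertex lies in the same copy `i` of `G` and again in `σ`, so it is the
    -- same vertex and `g * k = k`.
    have hmem : g • (⟨i, k⟩ : Σ _ : I, G) ∈ σ := by
      have := Finset.smul_mem_smul_finset (a := g) ha
      rwa [hg] at this
    have := hσ hmem ha rfl
    simpa using this

/-- A free `G`-space whose orbit map has a sectional cover of cardinality at most `n` admits an
equivariant map to each `G`-space that extends sphere maps in dimensions below `n`. -/
theorem IsSectionalCover.exists_equivariant (hfree : IsFreeAction G X)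
    {𝒰 : Set (Set (MulAction.orbitRel.Quotient G X))}
    (h𝒰 : IsSectionalCover (orbitMap G X) 𝒰)
    (hE : ∀ d : ℕ, ((d + 1 : ℕ) : ℕ∞) ≤ 𝒰.encard → ExtendsSphereMaps d Z) :
    ∃ φ : X → Z, Continuous φ ∧ ∀ (g : G) x, φ (g • x) = g • φ x := by
  classical
  rcases isEmpty_or_nonempty X with hX | ⟨⟨x₀⟩⟩
  · exact ⟨isEmptyElim, continuous_of_const fun x => isEmptyElim x, fun _ x => isEmptyElim x⟩
  have hslice (U : 𝒰) : ∃ A : Set X, IsOpenSlice G A ∧ orbitMap G X '' A = U := by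
    obtain ⟨s, hs⟩ := h𝒰.2.2 U U.2
    exact hs.exists_isOpenSlice hfree (h𝒰.1 U U.2)
  choose A hA hAU using hslice
  have : Nonempty Z := by
    obtain ⟨U, hU, -⟩ := sUnion_eq_univ_iff.1 h𝒰.2.1 (orbitMap G X x₀)
    -- For `d = 0` the sphere is empty and the ball is a point, so extending the empty map produces
    -- a point of `Z`.
    obtain ⟨F, -⟩ := hE 0 (by simpa [one_le_encard_iff_nonempty] using ⟨U, hU⟩)
      ⟨fun x => absurd x.2 (by simp [Subsingleton.elim x.1 0]),
        continuous_of_const fun x => absurd x.2 (by simp [Subsingleton.elim x.1 0])⟩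
    exact ⟨F ⟨0, by simp⟩⟩
  -- The vertex `(U, g)` of the join carries the translate by `g` of the slice over `U`.
  let W : (Σ _ : 𝒰, G) → Set X := fun v => (fun x => v.2⁻¹ • x) ⁻¹' A v.1
  obtain ⟨l, hlc, hlf, hlg, hl0, hlW, hl1⟩ := exists_equivariant_coordinates (G := G) W
    (fun v => (hA v.1).1.preimage (continuous_const_smul _))
    (by
      refine eq_univ_of_forall fun x => ?_
      obtain ⟨U, hU, hxU⟩ := sUnion_eq_univ_iff.1 h𝒰.2.1 (orbitMap G X x)
      obtain ⟨a, ha, hax⟩ := (hAU ⟨U, hU⟩).symm.subset hxU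
      obtain ⟨g, rfl⟩ := orbitMap_eq_iff.1 hax
      exact mem_iUnion.2 ⟨⟨⟨U, hU⟩, g⁻¹⟩, by simpa [W] using ha⟩)
    (fun g ⟨U, k⟩ x hx => by simpa [W, mul_smul] using hx)
  let K : Set (Finset (Σ _ : 𝒰, G)) := {σ | InjOn Sigma.fst (σ : Set (Σ _ : 𝒰, G))}
  have hK : IsFreeComplex G K := isFreeComplex_join G 𝒰
  -- A simplex has at most one vertex per member of `𝒰`, so its number of vertices `d + 1` is at
  -- most the size of the cover.
  obtain ⟨c, hc⟩ := hK.exists_equivariant (Z := Z) fun σ hσ d hd => hE d (by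
    rw [← hd, ← Finset.card_image_of_injOn hσ, ← encard_coe_eq_coe_finsetCard]
    exact (encard_le_encard (subset_univ _)).trans_eq (encard_univ _))
  have hlK (x : X) : ∃ σ ∈ K, l x ∈ geomSimplex σ := by
    have hfin : (Function.support (l x)).Finite := hlf.point_finite x
    refine ⟨hfin.toFinset, ?_, hl0 x, fun v hv => by simpa using hv, ?_⟩
    -- Distinct translates of one slice are disjoint, so the support of `l x` meets each copy of `G`
    -- at most once.
    · rintro ⟨i, g⟩ ha ⟨j, k⟩ hb hij
      obtain rfl : i = j := hij
      have ha' : g⁻¹ • x ∈ A i := hlW x _ (hfin.mem_toFinset.1 ha)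
      have hb' : k⁻¹ • x ∈ A i := hlW x _ (hfin.mem_toFinset.1 hb)
      have := (hA i).2 _ ha' (k⁻¹ * g) (by simpa [mul_smul] using hb')
      rw [inv_mul_eq_one] at this
      rw [this]
    · rw [← hl1 x, finsum_eq_sum_of_support_subset _ hfin.coe_toFinset.ge]
  refine ⟨c ∘ l, continuous_comp_coordinates hK.mono (fun σ hσ => (hc σ hσ).1) hlc hlf hlK,
    fun g x => ?_⟩
  obtain ⟨σ, hσ, hx⟩ := hlK x
  rw [Function.comp_apply, hlg, (hc σ hσ).2 g _ hx, Function.comp_apply]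

end Existence

/-! ### The equivalence -/

theorem theorem3p5 {G X Y : Type*} [Group G] {ℓ : ℕ} (h : G ≃ Fin ℓ)
    [TopologicalSpace X] [T2Space X] [ParacompactSpace X]
    [MulAction G X] [ContinuousConstSMul G X] (hfree : IsFreeAction G X)
    [TopologicalSpace Y] [T2Space Y]
    (q : ℕ) (hq : 2 ≤ q) (hqe : q ≤ ℓ.minFac)
    (hconn : ∀ n : ℕ, (n : ℕ∞) ≤ secatOrbit G (ConfSpace h Y q) →
      IsNConnected ((n : ℤ) - 2) (ConfSpace h Y q)) :
    HasBUP X G Y q ↔ secatOrbit G X > secatOrbit G (ConfSpace h Y q) := by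
  have : Finite G := Finite.of_equiv _ h.symm
  rw [hasBUP_iff_not_exists_equivariant h q, gt_iff_lt, ← not_le, not_iff_not]
  constructor
  · rintro ⟨φ, hφ, hequiv⟩
    exact secatOrbit_le_of_equivariant (ConfSpace.isFreeAction h q hqe) hφ hequiv
  · intro hle
    obtain ⟨𝒰, h𝒰, hcard⟩ := exists_isSectionalCover_encard_le hfree hle
    -- Extending maps of the `(d - 1)`-sphere needs `(d - 1)`-connectedness, which is the hypothesis
    -- `n - 2` at `n = d + 1`, the number of vertices of a `d`-simplex.
    exact h𝒰.exists_equivariant hfree fun d hd =>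
      hconn (d + 1) (hd.trans hcard) d (by push_cast; omega)
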